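/- All quantum systems are finite-dimensional and nonzero; $|X|$ is the dimension of the system $X$, $\mathbf u^{B}=I^{B}/|B|$ is the uniform state, and a channel is a completely positive trace-preserving linear map. Let $A,A',B$ be quantum systems and let $\Theta$ be a quantum superchannel from maps $A\to B$ to maps $A'\to B$: a linear map from the linear maps $\mathcal N^{A\to B}$ to the linear maps $A'\to B$ such that $\Theta[\mathcal N]$ is trace-preserving whenever $\mathcal N$ is, and, for all systems $C_0,C_1$, $\Theta\otimes\mathbb 1^{(C_0\to C_1)}$ (with $\mathbb 1^{(C_0\to C_1)}$ the identity on the linear maps $C_0\to C_1$) takes completely positive maps $AC_0\to BC_1$ to completely positive maps $A'C_0\to BC_1$. A realization of $\Theta$ consists of a system $R$, a channel $\mathcal E^{RB\to B}$ and an isometry $V:A'\to R\otimes A$ such that, with $\mathcal V(\rho)=V\rho V^\dagger$, $$\Theta[\mathcal N]=\mathcal E^{RB\to B}\circ(\mathsf{id}^R\otimes\mathcal N^{A\to B})\circ\mathcal V^{A'\to RA}\qquad\text{for all linear maps }\mathcal N^{A\to B}.$$ It is a standard form of $\Theta$ if $|R|$ is minimal among all realizations of $\Theta$. A channel $\mathcal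 E^{RB\to B}$ is conditionally unital if for every state $\tau$ on $R$ the map $\omega\mapsto\mathcal E(\tau\otimes\omega)$ is a doubly stochastic (i.e. unital) channel on $B$. The superchannel $\Theta$ is a mixing operation if it has a standard form in which $\mathcal E$ is conditionally unital. A channel $\mathcal N^{X\to BC}$ is marginally uniform with respect to $B$ if $\mathcal N=\mathbf u^B\otimes(\mathrm{Tr}_B\circ\mathcal N)$. Finally, $\Theta$ is completely uniformity-preserving if, for all systems $C_0,C_1$ and every channel $\mathcal N^{AC_0\to BC_1}$ that is marginally uniform with respect to $B$, the channel $(\Theta\otimes\mathbb 1^{(C_0\to C_1)})[\mathcal N]$ is marginally uniform with respect to $B$. **Theorem 11.** For every quantum superchannel $\Theta$ as above the following are equivalent: 1. $\Theta$ is completely uniformity-preserving. 2. The channel $(\Theta\otimes\mathbb 1^{C})[\mathbf u^{B}\otimes\mathsf{id}^{A\to C}]$ from $A'$ to $BC$ is marginally uniform with respect to $B$, where $C$ is a replica of $A$, $C_0$ is trivial and $C_1=C$. 3. $\Theta$ is a mixing operation. Moreover, for every standard form $(R,\mathcal E,\mathcal V)$ of $\Theta$, the channel $\mathcal E$ is conditionally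 unital if and only if $\Theta$ is completely uniformity-preserving. -/

import Mathlib

open Matrix
open scoped Kronecker ComplexOrder

namespace QChan

/-- Operators on the finite-dimensional quantum system `ℂ^X`. -/
abbrev Op (X : Type) : Type := Matrix X X ℂ

/-- `ρ` is a density matrix (a state). -/
def IsState {X : Type} [Fintype X] (ρ : Op X) : Prop :=
  ρ.PosSemidef ∧ ρ.trace = 1

/-- The maximally mixed (uniform) state. -/
noncomputable def uniform (X : Type) [Fintype X] [DecidableEq X] : Op X :=
  (Fintype.card X : ℂ)⁻¹ • (1 : Op X)

/-- The `(c, c')` block of an operator on `X ⊗ C`: `(id ⊗ ⟨c|) ρ (id ⊗ |c'⟩)`. -/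
def blockR {X C : Type} (ρ : Op (X × C)) (c c' : C) : Op X :=
  Matrix.of fun x x' => ρ (x, c) (x', c')

/-- The `(c, c')` block of an operator on `C ⊗ X`: `(⟨c| ⊗ id) ρ (|c'⟩ ⊗ id)`. -/
def blockL {C X : Type} (ρ : Op (C × X)) (c c' : C) : Op X :=
  Matrix.of fun x x' => ρ (c, x) (c', x')

/-- The map `Φ ⊗ id` from operators on `X ⊗ C` to operators on `Y ⊗ C`. -/
def tensorId {X Y : Type} (Φ : Op X →ₗ[ℂ] Op Y) (C : Type) :
    Op (X × C) →ₗ[ℂ] Op (Y × C) where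
  toFun ρ := Matrix.of fun p q => Φ (blockR ρ p.2 q.2) p.1 q.1
  map_add' ρ σ := by
    ext p q
    have h : blockR (ρ + σ) p.2 q.2 = blockR ρ p.2 q.2 + blockR σ p.2 q.2 := rfl
    simp [h]
  map_smul' z ρ := by
    ext p q
    have h : blockR (z • ρ) p.2 q.2 = z • blockR ρ p.2 q.2 := rfl
    simp [h]

/-- The map `id ⊗ Φ` from operators on `C ⊗ X` to operators on `C ⊗ Y`. -/
def idTensor (C : Type) {X Y : Type} (Φ : Op X →ₗ[ℂ] Op Y) :
    Op (C × X) →ₗ[ℂ] Op (C × Y) where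
  toFun ρ := Matrix.of fun p q => Φ (blockL ρ p.1 q.1) p.2 q.2
  map_add' ρ σ := by
    ext p q
    have h : blockL (ρ + σ) p.1 q.1 = blockL ρ p.1 q.1 + blockL σ p.1 q.1 := rfl
    simp [h]
  map_smul' z ρ := by
    ext p q
    have h : blockL (z • ρ) p.1 q.1 = z • blockL ρ p.1 q.1 := rfl
    simp [h]

/-- Complete positivity: `Φ ⊗ id` preserves positivity for every finite-dimensional ancilla. -/
def IsCP {X Y : Type} (Φ : Op X →ₗ[ℂ] Op Y) : Prop :=
  ∀ (n : ℕ) (ρ : Op (X × Fin n)), ρ.PosSemidef → (tensorId Φ (Fin n) ρ).PosSemidef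

/-- Trace preservation. -/
def IsTP {X Y : Type} [Fintype X] [Fintype Y] (Φ : Op X →ₗ[ℂ] Op Y) : Prop :=
  ∀ ρ : Op X, (Φ ρ).trace = ρ.trace

/-- Quantum channels: completely positive trace-preserving maps. -/
def IsChannel {X Y : Type} [Fintype X] [Fintype Y] (Φ : Op X →ₗ[ℂ] Op Y) : Prop :=
  IsCP Φ ∧ IsTP Φ

/-- Doubly stochastic (unital) channels. -/
def IsDoublyStochastic {X : Type} [Fintype X] [DecidableEq X] (Φ : Op X →ₗ[ℂ] Op X) : Prop :=
  IsChannel Φ ∧ Φ 1 = 1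

/-- The map `ρ ↦ V ρ V†`. -/
def conj {X Y : Type} [Fintype X] (V : Matrix Y X ℂ) : Op X →ₗ[ℂ] Op Y where
  toFun ρ := V * ρ * Vᴴ
  map_add' ρ σ := by simp [Matrix.mul_add, Matrix.add_mul]
  map_smul' z ρ := by simp

/-- Partial trace over the first factor. -/
def trLeft {B C : Type} [Fintype B] (ρ : Op (B × C)) : Op C :=
  ∑ b : B, blockL ρ b b

/-- `N : X → B ⊗ C` is marginally uniform with respect to `B`:
`N = u^B ⊗ N^{X → C}` with `N^{X → C} = Tr_B ∘ N`. -/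
def IsMarginallyUniform {X B C : Type} [Fintype B] [DecidableEq B]
    (N : Op X →ₗ[ℂ] Op (B × C)) : Prop :=
  ∀ ρ : Op X, N ρ = uniform B ⊗ₖ trLeft (N ρ)

/-- Linear supermaps, taking linear maps `A → B` to linear maps `A' → B'`. -/
abbrev Supermap (A B A' B' : Type) : Type :=
  (Op A →ₗ[ℂ] Op B) →ₗ[ℂ] (Op A' →ₗ[ℂ] Op B')

/-- For `N : A ⊗ C₀ → B ⊗ C₁`, the map
`X ↦ (id ⊗ ⟨c₁|) N(X ⊗ |c₀⟩⟨c₀'|) (id ⊗ |c₁'⟩)` from `A` to `B`; thus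
`N = ∑ component N c₀ c₀' c₁ c₁' ⊗ (ω ↦ ⟨c₀|ω|c₀'⟩ |c₁⟩⟨c₁'|)`. -/
def component {A B C₀ C₁ : Type} [DecidableEq C₀]
    (N : Op (A × C₀) →ₗ[ℂ] Op (B × C₁)) (c₀ c₀' : C₀) (c₁ c₁' : C₁) :
    Op A →ₗ[ℂ] Op B where
  toFun X := blockR (N (X ⊗ₖ Matrix.single c₀ c₀' (1 : ℂ))) c₁ c₁'
  map_add' X Y := by
    rw [Matrix.add_kronecker, map_add]; rfl
  map_smul' z X := by
    rw [Matrix.smul_kronecker, map_smul]; rfl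

/-- The action of `Θ ⊗ 𝟙^(C₀ → C₁)` on a map `N : A ⊗ C₀ → B ⊗ C₁`, where `𝟙` is the identity
supermap on maps `C₀ → C₁`: the supermap `Θ` is applied to the `A → B` components of `N`. -/
def extend {A B A' B' : Type} (Θ : Supermap A B A' B') {C₀ C₁ : Type} [Fintype C₀]
    [DecidableEq C₀] (N : Op (A × C₀) →ₗ[ℂ] Op (B × C₁)) :
    Op (A' × C₀) →ₗ[ℂ] Op (B' × C₁) where
  toFun Y := Matrix.of fun p q =>
    ∑ c₀ : C₀, ∑ c₀' : C₀, Θ (component N c₀ c₀' p.2 q.2) (blockR Y c₀ c₀') p.1 q.1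
  map_add' Y Z := by
    ext p q
    have h : ∀ c c', blockR (Y + Z) c c' = blockR Y c c' + blockR Z c c' := fun _ _ => rfl
    simp [h, Finset.sum_add_distrib]
  map_smul' z Y := by
    ext p q
    have h : ∀ c c', blockR (z • Y) c c' = z • blockR Y c c' := fun _ _ => rfl
    simp [h, Finset.mul_sum]

/-- A superchannel is a linear supermap that is completely CP-preserving and trace-preservation
preserving. -/
def IsSuperchannel {A B A' B' : Type} [Fintype A] [Fintype B] [Fintype A'] [Fintype B']
    (Θ : Supermap A B A' B') : Prop :=
  (∀ (C₀ C₁ : Type) [Fintype C₀] [DecidableEq C₀] [Fintype C₁] [DecidableEq C₁]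
    (N : Op (A × C₀) →ₗ[ℂ] Op (B × C₁)), IsCP N → IsCP (extend Θ N)) ∧
  ∀ N : Op A →ₗ[ℂ] Op B, IsTP N → IsTP (Θ N)

/-- `Θ` is implemented by the auxiliary system `R`, the post-processing channel `E : R ⊗ B → B`
and the pre-processing isometry `V : A' → R ⊗ A`, that is, `Θ[N] = E ∘ (id_R ⊗ N) ∘ 𝒱`
with `𝒱(ρ) = V ρ V†`. -/
def IsRealization {A B A' R : Type} [Fintype A] [Fintype B] [Fintype A'] [DecidableEq A']
    [Fintype R] (Θ : Supermap A B A' B)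
    (E : Op (R × B) →ₗ[ℂ] Op B) (V : Matrix (R × A) A' ℂ) : Prop :=
  IsChannel E ∧ Vᴴ * V = 1 ∧
    ∀ N : Op A →ₗ[ℂ] Op B, Θ N = E ∘ₗ idTensor R N ∘ₗ conj V

/-- A realization is a standard form if its auxiliary system has the smallest dimension among all
realizations of `Θ`. -/
def IsStandardForm {A B A' R : Type} [Fintype A] [Fintype B] [Fintype A'] [DecidableEq A']
    [Fintype R] (Θ : Supermap A B A' B)
    (E : Op (R × B) →ₗ[ℂ] Op B) (V : Matrix (R × A) A' ℂ) : Prop :=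
  IsRealization Θ E V ∧
    ∀ (r : ℕ) (E' : Op (Fin r × B) →ₗ[ℂ] Op B) (V' : Matrix (Fin r × A) A' ℂ),
      IsRealization Θ E' V' → Fintype.card R ≤ r

/-- The map `E_τ(ω) = E(τ ⊗ ω)`. -/
def condMap {R B : Type} (E : Op (R × B) →ₗ[ℂ] Op B) (τ : Op R) : Op B →ₗ[ℂ] Op B where
  toFun ω := E (τ ⊗ₖ ω)
  map_add' ω ω' := by rw [Matrix.kronecker_add, map_add]
  map_smul' z ω := by rw [Matrix.kronecker_smul, map_smul]; rfl

/-- `E : R ⊗ B → B` is conditionally unital: `E_τ` is doubly stochastic for every state `τ`. -/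
def IsConditionallyUnital {R B : Type} [Fintype R] [Fintype B] [DecidableEq B]
    (E : Op (R × B) →ₗ[ℂ] Op B) : Prop :=
  ∀ τ : Op R, IsState τ → IsDoublyStochastic (condMap E τ)

/-- `Θ` is a mixing operation: in standard form, its post-processing channel is conditionally
unital. -/
def IsMixing {A B A' : Type} [Fintype A] [Fintype B] [DecidableEq B] [Fintype A']
    [DecidableEq A'] (Θ : Supermap A B A' B) : Prop :=
  ∃ (r : ℕ) (E : Op (Fin r × B) →ₗ[ℂ] Op B) (V : Matrix (Fin r × A) A' ℂ),
    IsStandardForm Θ E V ∧ IsConditionallyUnital E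

/-- `Θ` is completely uniformity-preserving. -/
def IsCompletelyUniformityPreserving {A B A' B' : Type} [Fintype A] [Fintype B] [DecidableEq B]
    [Fintype B'] [DecidableEq B'] (Θ : Supermap A B A' B') : Prop :=
  ∀ (C₀ C₁ : Type) [Fintype C₀] [DecidableEq C₀] [Fintype C₁] [DecidableEq C₁]
    (N : Op (A × C₀) →ₗ[ℂ] Op (B × C₁)),
    IsChannel N → IsMarginallyUniform N → IsMarginallyUniform (extend Θ N)

/-- The channel `u^B ⊗ id^{A → C}`, with `C` a replica of `A`, sending `ρ` to `u^B ⊗ ρ`. The input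
is written as `A ⊗ C₀` with `C₀` the trivial one-dimensional system. -/
noncomputable def uniformId (A B : Type) [Fintype B] [DecidableEq B] :
    Op (A × Unit) →ₗ[ℂ] Op (B × A) where
  toFun ρ := uniform B ⊗ₖ blockR ρ () ()
  map_add' ρ σ := by
    rw [← Matrix.kronecker_add]; rfl
  map_smul' z ρ := by
    rw [RingHom.id_apply, ← Matrix.kronecker_smul]; rfl

end QChan

/-! In a realization `(E, V)` let `v_{a,c}` in `R` be the vector `(id_R ⊗ ⟨a|) V |c⟩`; these are the
columns of `ancilla V`. By linear extension from states, `E` is conditionally unital exactly when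
`E(X ⊗ u) = Tr(X) u` for every operator `X` on `R` (`isConditionallyUnital_iff`).

If this identity holds, the output of `Θ ⊗ 𝟙` on a marginally uniform channel is marginally uniform,
because every component of such a channel has outputs proportional to `u`. Conversely, the blocks of
`Θ ⊗ 𝟙` applied to `u ⊗ id` are the operators `E(|v_{a,c}⟩⟨v_{a',c'}| ⊗ u)`, so condition 2 gives
the identity on dyads of ancilla vectors (`apply_ancilla_kronecker_uniform`). Minimality of `R`
makes the `v_{a,c}` span `R`, since otherwise `R` could be compressed onto their span
(`exists_ancilla_mul_eq_one`). The dyads then span all operators on `R`, and the identity holds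
everywhere.

A standard form exists as soon as some realization does. That comes from factoring the Choi matrix
of `Θ`: complete CP-preservation makes it positive, and preservation of trace preservation makes its
marginal `Q ⊗ I_B`, with `Tr_A Q = I` (`exists_isRealization`). -/

namespace QChan

/-! ### Positive semidefinite matrices -/

/-- Spectral decomposition of a positive semidefinite matrix on its support. -/
theorem _root_.Matrix.PosSemidef.exists_isometry_diagonal {X : Type*} [Fintype X]
    {H : Matrix X X ℂ} (hH : H.PosSemidef) :
    ∃ (r : ℕ) (W : Matrix X (Fin r) ℂ) (d : Fin r → ℝ), (∀ i, 0 < d i) ∧ Wᴴ * W = 1 ∧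
      H = W * diagonal (fun i => (d i : ℂ)) * Wᴴ := by
  classical
  let U : Matrix X X ℂ := hH.1.eigenvectorUnitary
  let ev := hH.1.eigenvalues
  let S := {i // ev i ≠ 0}
  let e : Fin (Fintype.card S) ≃ S := (Fintype.equivFin S).symm
  have hU : Uᴴ * U = 1 := by
    have := (mem_unitaryGroup_iff'.1 (hH.1.eigenvectorUnitary).2)
    simpa [star_eq_conjTranspose] using this
  have hspec : H = U * diagonal (fun i => (ev i : ℂ)) * Uᴴ := by
    have := hH.1.spectral_theorem
    rw [Unitary.conjStarAlgAut_apply] at this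
    exact this
  refine ⟨Fintype.card S, U.submatrix id (fun i => (e i : X)), fun i => ev (e i), ?_, ?_, ?_⟩
  · intro i
    exact lt_of_le_of_ne (hH.eigenvalues_nonneg _) (Ne.symm (e i).2)
  · ext i j
    have := congrFun (congrFun hU (e i)) (e j)
    simp only [mul_apply, conjTranspose_apply, submatrix_apply, id, one_apply] at this ⊢
    rw [this]
    simp [Subtype.ext_iff.symm]
  · ext x y
    conv_lhs => rw [hspec]
    rw [mul_apply, mul_apply]
    simp only [mul_diagonal, conjTranspose_apply, submatrix_apply, id]
    rw [e.sum_comp (fun s : S => U x s * (ev s : ℂ) * star (U y s)),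
      ← Finset.sum_subtype (Finset.univ.filter fun i => ev i ≠ 0) (by simp)
        (fun i => U x i * (ev i : ℂ) * star (U y i)), Finset.sum_filter]
    refine Finset.sum_congr rfl fun i _ => ?_
    by_cases h : ev i = 0 <;> simp [h]

/-- A positive semidefinite matrix factors as `T * Tᴴ` with `T` of full column rank. -/
theorem _root_.Matrix.PosSemidef.exists_fullRank_factorization {X : Type*} [Fintype X]
    {H : Matrix X X ℂ} (hH : H.PosSemidef) :
    ∃ (r : ℕ) (T : Matrix X (Fin r) ℂ) (L : Matrix (Fin r) X ℂ), H = T * Tᴴ ∧ L * T = 1 := by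
  obtain ⟨r, W, d, hd, hW, hH⟩ := hH.exists_isometry_diagonal
  refine ⟨r, W * diagonal (fun i => (Real.sqrt (d i) : ℂ)),
    diagonal (fun i => ((Real.sqrt (d i))⁻¹ : ℂ)) * Wᴴ, ?_, ?_⟩
  · rw [hH, conjTranspose_mul, diagonal_conjTranspose]
    have : diagonal (fun i => (d i : ℂ)) = diagonal (fun i => (Real.sqrt (d i) : ℂ)) *
        diagonal (star fun i => (Real.sqrt (d i) : ℂ)) := by
      rw [diagonal_mul_diagonal]
      congr 1
      ext i
      simp only [Pi.star_apply, RCLike.star_def, Complex.conj_ofReal]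
      rw [← Complex.ofReal_mul, Real.mul_self_sqrt (hd i).le]
    rw [this]
    simp only [Matrix.mul_assoc]
  · rw [Matrix.mul_assoc, ← Matrix.mul_assoc Wᴴ, hW, Matrix.one_mul, diagonal_mul_diagonal,
      ← diagonal_one]
    congr 1
    ext i
    have : (Real.sqrt (d i) : ℂ) ≠ 0 := by exact_mod_cast (Real.sqrt_pos.2 (hd i)).ne'
    exact inv_mul_cancel₀ this

/-- A linear map on operators is determined by its values on the operators `|x⟩⟨x|`. -/
theorem linearMap_ext_of_vecMulVec {X M : Type*} [Fintype X] [AddCommGroup M]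
    [Module ℂ M] {F G : Matrix X X ℂ →ₗ[ℂ] M}
    (h : ∀ x : X → ℂ, F (vecMulVec x (star x)) = G (vecMulVec x (star x))) : F = G := by
  classical
  have key : ∀ x y : X → ℂ, F (vecMulVec x (star y)) = G (vecMulVec x (star y)) := by
    intro x y
    rw [← sub_eq_zero, ← LinearMap.sub_apply]
    have h0 : ∀ x : X → ℂ, (F - G) (vecMulVec x (star x)) = 0 := fun x => by
      rw [LinearMap.sub_apply, h, sub_self]
    -- Polarization: the cross terms at `x + y` and at `x + iy` give the sum and the difference of
    -- the two mixed values, so both vanish.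
    have h1 := h0 (x + y)
    have h2 := h0 (x + Complex.I • y)
    simp only [star_add, star_smul, vecMulVec_add, add_vecMulVec, vecMulVec_smul, smul_vecMulVec,
      map_add, map_smul, h0, smul_zero, zero_add, add_zero, RCLike.star_def, Complex.conj_I] at h1 h2
    have h3 : (F - G) (vecMulVec y (star x)) = -(F - G) (vecMulVec x (star y)) :=
      eq_neg_of_add_eq_zero_left h1
    rw [h3, smul_neg, neg_smul, ← neg_add, neg_eq_zero, ← two_smul ℂ, smul_smul] at h2
    exact (smul_eq_zero.1 h2).resolve_left (by simp)
  refine Matrix.ext_linearMap ℂ fun i j => ?_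
  ext
  have := key (Pi.single i 1) (Pi.single j 1)
  have hs : (star (Pi.single j (1 : ℂ)) : X → ℂ) = Pi.single j 1 := by
    rw [← Pi.single_star, star_one]
  rw [hs, ← Matrix.single_eq_single_vecMulVec_single] at this
  simpa using this

/-! ### Completely positive maps -/

theorem IsCP.posSemidef_tensorId {X Y C : Type} [Finite C] {Φ : Op X →ₗ[ℂ] Op Y}
    (h : IsCP Φ) {ρ : Op (X × C)} (hρ : ρ.PosSemidef) : (tensorId Φ C ρ).PosSemidef := by
  obtain ⟨n, ⟨e⟩⟩ := Finite.exists_equiv_fin C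
  have h1 := (h n _ (hρ.submatrix (Prod.map id e.symm))).submatrix (Prod.map id e : Y × C → _)
  convert h1 using 1
  ext p q
  refine congrArg (fun M => Φ M p.1 q.1) ?_
  ext x x'
  simp [blockR]

theorem IsCP.comp {X Y Z : Type} {Ψ : Op Y →ₗ[ℂ] Op Z} {Φ : Op X →ₗ[ℂ] Op Y}
    (hΨ : IsCP Ψ) (hΦ : IsCP Φ) : IsCP (Ψ ∘ₗ Φ) :=
  fun n ρ hρ => hΨ n _ (hΦ n ρ hρ)

theorem isCP_conj {X Y : Type} [Fintype X] [Fintype Y] (K : Matrix Y X ℂ) : IsCP (conj K) := by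
  intro n ρ hρ
  have : tensorId (conj K) (Fin n) ρ =
      (K ⊗ₖ (1 : Op (Fin n))) * ρ * (K ⊗ₖ (1 : Op (Fin n)))ᴴ := by
    ext ⟨y, c⟩ ⟨y', c'⟩
    simp [tensorId, conj, mul_apply, blockR, Fintype.sum_prod_type, one_apply, kroneckerMap_apply,
      apply_ite]
  rw [this]
  exact hρ.mul_mul_conjTranspose_same _

theorem isCP_sum {X Y ι : Type} [Fintype ι] {Φ : ι → Op X →ₗ[ℂ] Op Y}
    (h : ∀ i, IsCP (Φ i)) : IsCP (∑ i, Φ i) := by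
  intro n ρ hρ
  have : tensorId (∑ i, Φ i) (Fin n) ρ = ∑ i, tensorId (Φ i) (Fin n) ρ := by
    ext p q
    simp [tensorId, Matrix.sum_apply]
  rw [this]
  exact posSemidef_sum _ fun i _ => h i n ρ hρ

/-- The Choi matrix of a completely positive map is positive semidefinite. -/
theorem IsCP.posSemidef_choi {X Y : Type} [Finite X] [DecidableEq X] {Φ : Op X →ₗ[ℂ] Op Y}
    (h : IsCP Φ) :
    (Matrix.of fun p q : Y × X => Φ (single p.2 q.2 1) p.1 q.1).PosSemidef := by
  cases nonempty_fintype X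
  -- The unnormalized maximally entangled vector.
  let φ : X × X → ℂ := fun p => if p.1 = p.2 then 1 else 0
  convert h.posSemidef_tensorId (posSemidef_vecMulVec_self_star φ) using 1
  ext p q
  refine congrArg (fun M => Φ M p.1 q.1) ?_
  ext x x'
  simp only [blockR, of_apply, vecMulVec_apply, φ, Pi.star_apply, single_apply, eq_comm (a := p.2),
    eq_comm (a := q.2), ite_and]
  split_ifs <;> simp

/-- The map `ρ ↦ τ ⊗ ρ`. -/
def kroneckerLeft {B : Type} (τ : Op B) (X : Type) : Op X →ₗ[ℂ] Op (B × X) where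
  toFun ρ := τ ⊗ₖ ρ
  map_add' _ _ := kronecker_add _ _ _
  map_smul' _ _ := kronecker_smul _ _ _

/-- The map `ρ ↦ ρ ⊗ σ`. -/
def kroneckerRight (X : Type) {B : Type} (σ : Op B) : Op X →ₗ[ℂ] Op (X × B) where
  toFun ρ := ρ ⊗ₖ σ
  map_add' _ _ := add_kronecker _ _ _
  map_smul' _ _ := smul_kronecker _ _ _

theorem isCP_kroneckerLeft {X B : Type} [Fintype X] [Fintype B] {τ : Op B}
    (hτ : τ.PosSemidef) : IsCP (kroneckerLeft τ X) := by
  intro n ρ hρ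
  have h : tensorId (kroneckerLeft τ X) (Fin n) ρ =
      (τ ⊗ₖ ρ).submatrix (Equiv.prodAssoc B X (Fin n)) (Equiv.prodAssoc B X (Fin n)) := by
    ext p q
    simp [tensorId, kroneckerLeft, blockR]
  rw [h]
  exact (hτ.kronecker hρ).submatrix _

/-! ### The Choi matrix of a supermap -/

/-- The map `X ↦ ⟨a|X|a'⟩ |b⟩⟨b'|`. -/
def elementary {A B : Type} [DecidableEq B] (a a' : A) (b b' : B) : Op A →ₗ[ℂ] Op B where
  toFun X := X a a' • single b b' 1
  map_add' X Y := by rw [Matrix.add_apply, add_smul]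
  map_smul' z X := by rw [Matrix.smul_apply, smul_assoc, RingHom.id_apply]

theorem elementary_apply {A B : Type} [DecidableEq B] (a a' : A) (b b' : B) (X : Op A) :
    elementary a a' b b' X = X a a' • single b b' 1 := rfl

theorem eq_sum_elementary {A B : Type} [Fintype A] [DecidableEq A] [Fintype B] [DecidableEq B]
    (N : Op A →ₗ[ℂ] Op B) :
    N = ∑ a, ∑ a', ∑ b, ∑ b', N (single a a' 1) b b' • elementary a a' b b' := by
  refine LinearMap.ext fun X => ?_
  simp only [LinearMap.sum_apply, LinearMap.smul_apply, elementary_apply]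
  conv_lhs => rw [matrix_eq_sum_single X, map_sum]
  refine Finset.sum_congr rfl fun a _ => ?_
  rw [map_sum]
  refine Finset.sum_congr rfl fun a' _ => ?_
  have : single a a' (X a a') = X a a' • single a a' (1 : ℂ) := by simp
  rw [this, map_smul]
  conv_lhs => rw [matrix_eq_sum_single (N (single a a' 1)), Finset.smul_sum]
  refine Finset.sum_congr rfl fun b _ => ?_
  rw [Finset.smul_sum]
  refine Finset.sum_congr rfl fun b' _ => ?_
  simp [mul_comm]

theorem supermap_ext {A B A' B' : Type} [Fintype A] [DecidableEq A] [Fintype B] [DecidableEq B]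
    [Fintype A'] [DecidableEq A'] {Θ Θ' : Supermap A B A' B'}
    (h : ∀ a a' b b' c c', Θ (elementary a a' b b') (single c c' 1) =
      Θ' (elementary a a' b b') (single c c' 1)) : Θ = Θ' := by
  have h' : ∀ a a' b b', Θ (elementary a a' b b') = Θ' (elementary a a' b b') := by
    intro a a' b b'
    refine Matrix.ext_linearMap ℂ fun c c' => ?_
    refine LinearMap.ext fun z => ?_
    have : single c c' z = z • single c c' (1 : ℂ) := by simp
    simp only [LinearMap.comp_apply, singleLinearMap_apply]
    rw [this, map_smul, map_smul, h]
  refine LinearMap.ext fun N => ?_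
  rw [eq_sum_elementary N]
  simp only [map_sum, map_smul, h']

/-- The Choi matrix of a supermap. -/
def choi {A B A' B' : Type} [DecidableEq B] [DecidableEq A'] (Θ : Supermap A B A' B') :
    Op ((A × A') × (B × B')) :=
  Matrix.of fun p q =>
    Θ (elementary p.1.1 q.1.1 p.2.1 q.2.1) (single p.1.2 q.1.2 1) p.2.2 q.2.2

/-- Conjugation by `|Ω_B⟩⟨Ω_A|`, with `Ω` unnormalized maximally entangled, is one CP map having all
elementary maps as components, so a single application of `Θ ⊗ 𝟙` records every value of `Θ`. -/
theorem component_conj_maximallyEntangled {A B : Type} [Fintype A] [DecidableEq A]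
    [DecidableEq B] (a a' : A) (b b' : B) :
    component (conj (Matrix.of fun (p : B × B) (q : A × A) =>
      if p.1 = p.2 ∧ q.1 = q.2 then (1 : ℂ) else 0)) a a' b b' = elementary a a' b b' := by
  refine LinearMap.ext fun X => ?_
  ext x y
  simp only [component, conj, blockR, elementary_apply, LinearMap.coe_mk, AddHom.coe_mk, of_apply,
    mul_apply, conjTranspose_apply, Fintype.sum_prod_type, kroneckerMap_apply, single_apply,
    Matrix.smul_apply, ite_and]
  by_cases hx : x = b <;> by_cases hy : y = b' <;>
    simp [hx, hy, eq_comm (a := b), eq_comm (a := b')]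

/-- With `C₀ = A` and `C₁ = B`, extending `Θ` to the CP map above yields a CP map whose ordinary
Choi matrix is `choi Θ` up to reordering tensor factors. -/
theorem IsSuperchannel.posSemidef_choi {A B A' B' : Type} [Fintype A] [DecidableEq A] [Fintype B]
    [DecidableEq B] [Fintype A'] [DecidableEq A'] [Fintype B'] {Θ : Supermap A B A' B'}
    (hΘ : IsSuperchannel Θ) : (choi Θ).PosSemidef := by
  have h := (hΘ.1 A B _ (isCP_conj (Matrix.of fun (p : B × B) (q : A × A) =>
      if p.1 = p.2 ∧ q.1 = q.2 then (1 : ℂ) else 0))).posSemidef_choi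
  convert h.submatrix (fun p : (A × A') × (B × B') => ((p.2.2, p.2.1), (p.1.2, p.1.1))) using 1
  ext ⟨⟨a, c⟩, b, d⟩ ⟨⟨a', c'⟩, b', d'⟩
  have hb : ∀ x x' : A, blockR (single (c, a) (c', a') (1 : ℂ)) x x' =
      if x = a then if x' = a' then single c c' 1 else 0 else 0 := by
    intro x x'
    ext y y'
    by_cases hx : x = a <;> by_cases hx' : x' = a' <;>
      simp [blockR, single_apply, hx, hx', eq_comm (a := a), eq_comm (a := a')]
  simp only [choi, of_apply, submatrix_apply, extend, LinearMap.coe_mk, AddHom.coe_mk,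
    component_conj_maximallyEntangled, hb]
  rw [Finset.sum_eq_single a, Finset.sum_eq_single a'] <;> simp +contextual

/-! ### Constraints from preservation of trace preservation -/

section Trace

variable {A B A' B' : Type} [Fintype A] [Fintype B] [Fintype A'] [Fintype B']
  {Θ : Supermap A B A' B'}

/-- The map `X ↦ Tr(X) |b⟩⟨b|`. -/
def prepare (A : Type) {B : Type} [Fintype A] [DecidableEq B] (b : B) : Op A →ₗ[ℂ] Op B where
  toFun X := X.trace • single b b 1
  map_add' X Y := by rw [Matrix.trace_add, add_smul]
  map_smul' z X := by rw [Matrix.trace_smul, smul_assoc, RingHom.id_apply]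

theorem isTP_prepare [DecidableEq B] (b : B) : IsTP (prepare A b) := by
  intro X
  simp [prepare]

/-- A trace-annihilating map is the difference of two trace-preserving ones, `N + prepare A b` and
`prepare A b`. -/
theorem IsSuperchannel.trace_eq_zero [DecidableEq B] [Nonempty B] (hΘ : IsSuperchannel Θ)
    {N : Op A →ₗ[ℂ] Op B} (hN : ∀ X, (N X).trace = 0) (ρ : Op A') : (Θ N ρ).trace = 0 := by
  obtain ⟨b⟩ := ‹Nonempty B›
  have h1 := hΘ.2 _ (isTP_prepare (A := A) b) ρ
  have h2 := hΘ.2 (N + prepare A b) (fun X => by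
    rw [LinearMap.add_apply, trace_add, hN, zero_add, isTP_prepare b X]) ρ
  rw [map_add, LinearMap.add_apply, trace_add, h1] at h2
  simpa using h2

/-- Both the difference of two diagonal elementary maps and an off-diagonal one annihilate the
trace. Hence the Choi matrix, traced over the output, is `Q ⊗ I_B`. -/
theorem IsSuperchannel.trace_elementary [DecidableEq B] [Nonempty B] (hΘ : IsSuperchannel Θ)
    (a a' : A) (b b' d : B) (ρ : Op A') :
    (Θ (elementary a a' b b') ρ).trace =
      if b = b' then (Θ (elementary a a' d d) ρ).trace else 0 := by
  split_ifs with h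
  · subst h
    rw [← sub_eq_zero, ← trace_sub, ← LinearMap.sub_apply, ← map_sub]
    exact hΘ.trace_eq_zero (fun X => by simp [elementary_apply, trace_sub]) ρ
  · exact hΘ.trace_eq_zero (fun X => by simp [elementary_apply, trace_single_eq_of_ne, h]) ρ

theorem IsSuperchannel.sum_trace_elementary [DecidableEq B] (hΘ : IsSuperchannel Θ) (d : B)
    (ρ : Op A') : ∑ a, (Θ (elementary a a d d) ρ).trace = ρ.trace := by
  rw [← hΘ.2 _ (isTP_prepare (A := A) d) ρ, ← trace_sum, ← LinearMap.sum_apply, ← map_sum]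
  congr 3
  refine LinearMap.ext fun X => ?_
  simp only [LinearMap.sum_apply, elementary_apply, ← Finset.sum_smul]
  rfl

end Trace

/-! ### Realizations of superchannels -/

/-- The supermap `N ↦ E ∘ (id_R ⊗ N) ∘ 𝒱`. -/
def realizedBy {A B A' B' R : Type} [Fintype A'] (E : Op (R × B) →ₗ[ℂ] Op B')
    (V : Matrix (R × A) A' ℂ) : Supermap A B A' B' where
  toFun N := E ∘ₗ idTensor R N ∘ₗ conj V
  map_add' N N' := by
    rw [← LinearMap.comp_add, ← LinearMap.add_comp]; rfl
  map_smul' z N := by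
    rw [RingHom.id_apply, ← LinearMap.comp_smul, ← LinearMap.smul_comp]; rfl

/-- The vector `(id_R ⊗ ⟨a|) V |a'⟩` of the auxiliary system. -/
def ancilla {A A' R : Type} (V : Matrix (R × A) A' ℂ) : Matrix R (A × A') ℂ :=
  Matrix.of fun r p => V (r, p.1) p.2

theorem blockR_conj_single {A A' R : Type} [Fintype A'] [DecidableEq A']
    (V : Matrix (R × A) A' ℂ) (a a' : A) (c c' : A') :
    blockR (conj V (single c c' 1)) a a' =
      vecMulVec ((ancilla V).col (a, c)) (star ((ancilla V).col (a', c'))) := by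
  ext r r'
  simp [blockR, conj, ancilla, mul_apply, vecMulVec_apply, single_apply, ite_and]

theorem idTensor_elementary {A B R : Type} [DecidableEq B] (a a' : A) (b b' : B)
    (Z : Op (R × A)) :
    idTensor R (elementary a a' b b') Z = blockR Z a a' ⊗ₖ single b b' 1 := rfl

theorem conj_vecMulVec {X Y : Type} [Fintype X] (K : Matrix Y X ℂ) (x y : X → ℂ) :
    conj K (vecMulVec x (star y)) = vecMulVec (K *ᵥ x) (star (K *ᵥ y)) := by
  change K * vecMulVec x (star y) * Kᴴ = _
  rw [mul_vecMulVec, vecMulVec_mul, star_mulVec]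

theorem vecMulVec_kronecker_single {B R : Type} [DecidableEq B] (x y : R → ℂ) (b b' : B) :
    vecMulVec x (star y) ⊗ₖ single b b' (1 : ℂ) =
      vecMulVec (fun s : R × B => x s.1 * Pi.single (M := fun _ => ℂ) b 1 s.2)
        (star fun s : R × B => y s.1 * Pi.single (M := fun _ => ℂ) b' 1 s.2) := by
  ext ⟨r, d⟩ ⟨r', d'⟩
  by_cases h : d = b <;> by_cases h' : d' = b' <;>
    simp [vecMulVec_apply, Pi.single_apply, h, h', eq_comm (a := b),
      eq_comm (a := b')]

theorem isTP_sum_conj {X Y ι : Type} [Fintype X] [DecidableEq X] [Fintype Y] [Fintype ι]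
    {F : ι → Matrix Y X ℂ} (hF : ∑ k, (F k)ᴴ * F k = 1) : IsTP (∑ k, conj (F k)) := by
  intro Z
  simp only [LinearMap.sum_apply, trace_sum, conj, LinearMap.coe_mk, AddHom.coe_mk]
  simp only [trace_mul_cycle (F _) Z]
  rw [← trace_sum, ← Finset.sum_mul, hF, Matrix.one_mul]

/-- Every superchannel is realized by an isometric pre-processing and a post-processing channel. -/
theorem IsSuperchannel.exists_isRealization {A A' B : Type} [Fintype A] [DecidableEq A]
    [Fintype A'] [DecidableEq A'] [Fintype B] [DecidableEq B] [Nonempty B]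
    {Θ : Supermap A B A' B} (hΘ : IsSuperchannel Θ) :
    ∃ (r : ℕ) (E : Op (Fin r × B) →ₗ[ℂ] Op B) (V : Matrix (Fin r × A) A' ℂ),
      IsRealization Θ E V := by
  obtain ⟨m, S, -, hS, -⟩ := hΘ.posSemidef_choi.exists_fullRank_factorization
  obtain ⟨d⟩ := id ‹Nonempty B›
  -- The Choi marginal; the choice of `d` is immaterial by `trace_elementary`.
  let Q : Op (A × A') := Matrix.of fun p q =>
    (Θ (elementary p.1 q.1 d d) (single p.2 q.2 1)).trace
  let G : B → Matrix (A × A') (B × Fin m) ℂ := fun b => Matrix.of fun p s => S (p, (b, s.1)) s.2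
  have hG : ∀ b b', G b * (G b')ᴴ = if b = b' then Q else 0 := by
    intro b b'
    ext p q
    have h1 : (G b * (G b')ᴴ) p q =
        (Θ (elementary p.1 q.1 b b') (single p.2 q.2 1)).trace := by
      have h2 : ∀ x, choi Θ (p, (b, x)) (q, (b', x)) = (S * Sᴴ) (p, (b, x)) (q, (b', x)) :=
        fun x => by rw [← hS]
      simp only [trace, diag_apply]
      simp only [choi, of_apply] at h2
      simp only [h2, mul_apply, Fintype.sum_prod_type, conjTranspose_apply, G, of_apply]
    rw [h1, hΘ.trace_elementary _ _ _ _ d]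
    split_ifs <;> rfl
  have hQ : Q.PosSemidef := by
    have := hG d d
    rw [if_pos rfl] at this
    rw [← this]
    exact posSemidef_self_mul_conjTranspose _
  obtain ⟨r, T, L, hT, hL⟩ := hQ.exists_fullRank_factorization
  have hsupp : ∀ b, T * (L * G b) = G b := by
    intro b
    -- `G b` has the same range as `Q = G b * (G b)ᴴ`, and `T * L` fixes that range because `L * T =
    -- 1`.
    have h0 : (1 - T * L) * (G b * (G b)ᴴ) = 0 := by
      rw [hG, if_pos rfl, hT, Matrix.sub_mul, Matrix.one_mul, Matrix.mul_assoc T L,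
        ← Matrix.mul_assoc L, hL, Matrix.one_mul, sub_self]
    rw [mul_self_mul_conjTranspose_eq_zero, Matrix.sub_mul, Matrix.one_mul, sub_eq_zero,
      Matrix.mul_assoc] at h0
    exact h0.symm
  -- Kraus operators of `E`, read off from the coordinates `L * G b` of `G b` in the columns of `T`.
  -- Completeness reduces to `L Q Lᴴ = (L T)(L T)ᴴ = 1`.
  let F : Fin m → Matrix B (Fin r × B) ℂ := fun k =>
    Matrix.of fun x s => (L * G s.2) s.1 (x, k)
  let V : Matrix (Fin r × A) A' ℂ := Matrix.of fun s c => T (s.2, c) s.1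
  have hF : ∑ k, (F k)ᴴ * F k = 1 := by
    ext ⟨s, b⟩ ⟨s', b'⟩
    have h1 : (∑ k, (F k)ᴴ * F k) (s, b) (s', b') = ((L * G b') * (L * G b)ᴴ) s' s := by
      simp only [Matrix.sum_apply, mul_apply (M := (F _)ᴴ), mul_apply (M := L * G b'),
        Fintype.sum_prod_type, conjTranspose_apply, F, of_apply]
      rw [Finset.sum_comm]
      simp only [mul_comm]
    have h2 : (L * T) * (L * T)ᴴ = L * Q * Lᴴ := by
      rw [hT, conjTranspose_mul]; simp only [Matrix.mul_assoc]
    rw [h1, conjTranspose_mul, Matrix.mul_assoc, ← Matrix.mul_assoc (G b'), hG,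
      ← Matrix.mul_assoc]
    by_cases h : b = b'
    · rw [if_pos h.symm, ← h2, hL]
      simp [one_apply, h, eq_comm]
    · rw [if_neg (Ne.symm h)]
      simp [one_apply, h]
  -- Isometry of `V` amounts to `Tr_A Q = I`.
  have hV : Vᴴ * V = 1 := by
    ext c c'
    have h1 : (Vᴴ * V) c c' = ∑ a, (T * Tᴴ) (a, c') (a, c) := by
      simp only [mul_apply, conjTranspose_apply, Fintype.sum_prod_type, V, of_apply]
      rw [Finset.sum_comm]
      simp only [mul_comm]
    rw [h1, ← hT]
    simp only [Q, of_apply]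
    rw [hΘ.sum_trace_elementary]
    by_cases h : c = c'
    · subst h
      rw [trace_single_eq_same, one_apply_eq]
    · rw [trace_single_eq_of_ne _ _ _ (Ne.symm h), one_apply_ne h]
  refine ⟨r, ∑ k, conj (F k), V, ⟨isCP_sum fun k => isCP_conj _, isTP_sum_conj hF⟩, hV, ?_⟩
  suffices h : Θ = realizedBy (∑ k, conj (F k)) V from fun N => by
    conv_lhs => rw [h]
    rfl
  refine supermap_ext fun a a' b b' c c' => ?_
  -- `F k` sends `v_p ⊗ |b⟩` to the part of column `k` of `S` indexed by `(p, b)`, so the realized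
  -- supermap has Choi matrix `S * Sᴴ`.
  have hFv : ∀ k b (p : A × A'), (F k *ᵥ fun s : Fin r × B => (ancilla V).col p s.1 *
      Pi.single (M := fun _ => ℂ) b 1 s.2) = fun x => S (p, (b, x)) k := by
    intro k b p
    ext x
    have h1 := congrFun (congrFun (hsupp b) p) (x, k)
    simp only [mul_apply (M := T)] at h1
    simp only [G, of_apply] at h1
    rw [← h1]
    simp only [mulVec, dotProduct, Fintype.sum_prod_type, F, of_apply, ancilla, V, col_apply]
    refine Finset.sum_congr rfl fun s _ => ?_
    simp [Pi.single_apply, mul_comm, G]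
  change _ = (∑ k, conj (F k)) (idTensor (Fin r) (elementary a a' b b') (conj V (single c c' 1)))
  rw [idTensor_elementary, blockR_conj_single, vecMulVec_kronecker_single]
  simp only [LinearMap.sum_apply, conj_vecMulVec, hFv]
  ext x x'
  have h2 : choi Θ ((a, c), (b, x)) ((a', c'), (b', x')) =
    (S * Sᴴ) ((a, c), (b, x)) ((a', c'), (b', x')) := by rw [← hS]
  simp only [choi, of_apply] at h2
  rw [h2, Matrix.sum_apply]
  rfl

/-! ### Conditional unitality -/

theorem idTensor_smul_const {A B R : Type} {Φ : Op A →ₗ[ℂ] Op B} {g : Op A → ℂ} {σ : Op B}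
    (h : ∀ X, Φ X = g X • σ) (Z : Op (R × A)) :
    idTensor R Φ Z = (Matrix.of fun r r' => g (blockL Z r r')) ⊗ₖ σ := by
  ext p q
  simp [idTensor, h]

section Uniform

variable {B : Type} [Fintype B] [DecidableEq B]

theorem posSemidef_uniform : (uniform B).PosSemidef := by
  have h : (0 : ℂ) ≤ (Fintype.card B : ℂ)⁻¹ := by
    rw [← Complex.ofReal_natCast, ← Complex.ofReal_inv]
    exact Complex.zero_le_real.2 (by positivity)
  exact PosSemidef.one.smul h

theorem card_smul_uniform [Nonempty B] : (Fintype.card B : ℂ) • uniform B = 1 := by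
  rw [uniform, smul_smul, mul_inv_cancel₀ (by simp), one_smul]

theorem trace_uniform [Nonempty B] : (uniform B).trace = 1 := by
  rw [uniform, trace_smul, trace_one, smul_eq_mul, inv_mul_cancel₀ (by simp)]

theorem trLeft_kronecker {B C : Type} [Fintype B] (τ : Op B) (M : Op C) :
    trLeft (τ ⊗ₖ M) = τ.trace • M := by
  ext c c'
  simp [trLeft, blockL, Matrix.sum_apply, trace, Finset.sum_mul]

theorem isMarginallyUniform_of_exists {X C : Type} [Nonempty B] {N : Op X →ₗ[ℂ] Op (B × C)}
    (h : ∀ ρ, ∃ M : Op C, N ρ = uniform B ⊗ₖ M) : IsMarginallyUniform N := by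
  intro ρ
  obtain ⟨M, hM⟩ := h ρ
  rw [hM, trLeft_kronecker, trace_uniform, one_smul]

theorem condMap_eq_comp {R B : Type} (E : Op (R × B) →ₗ[ℂ] Op B) (τ : Op R) :
    condMap E τ = E ∘ₗ kroneckerLeft τ B :=
  LinearMap.ext fun _ => rfl

theorem isChannel_condMap {R B : Type} [Fintype R] [Fintype B] {E : Op (R × B) →ₗ[ℂ] Op B}
    (hE : IsChannel E) {τ : Op R} (hτ : IsState τ) : IsChannel (condMap E τ) := by
  refine ⟨?_, fun ω => ?_⟩
  · rw [condMap_eq_comp]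
    exact hE.1.comp (isCP_kroneckerLeft hτ.1)
  · change (E (τ ⊗ₖ ω)).trace = _
    rw [hE.2, trace_kronecker, hτ.2, one_mul]

/-- A channel is conditionally unital iff it maps `X ⊗ u` to `Tr(X) u`. -/
theorem isConditionallyUnital_iff {R : Type} [Fintype R] [Nonempty B]
    {E : Op (R × B) →ₗ[ℂ] Op B} (hE : IsChannel E) :
    IsConditionallyUnital E ↔ ∀ X : Op R, E (X ⊗ₖ uniform B) = X.trace • uniform B := by
  constructor
  · intro h
    let F : Op R →ₗ[ℂ] Op B := E ∘ₗ kroneckerRight R (uniform B)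
    let G : Op R →ₗ[ℂ] Op B := (traceLinearMap R ℂ ℂ).smulRight (uniform B)
    suffices hFG : F = G from fun X => LinearMap.congr_fun hFG X
    refine linearMap_ext_of_vecMulVec fun x => ?_
    have hx := posSemidef_vecMulVec_self_star x
    set P : Op R := vecMulVec x (star x)
    -- A traceless positive `P` is zero; otherwise `P / Tr P` is a state, to which the hypothesis
    -- applies.
    by_cases ht : P.trace = 0
    · rw [hx.trace_eq_zero_iff.1 ht, map_zero, map_zero]
    · have ht0 : 0 ≤ (P.trace)⁻¹ := by
        obtain ⟨t, ht', hteq⟩ : ∃ t : ℝ, 0 ≤ t ∧ P.trace = t :=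
          ⟨P.trace.re, (Complex.le_def.1 hx.trace_nonneg).1,
            Complex.ext rfl (Complex.le_def.1 hx.trace_nonneg).2.symm⟩
        rw [hteq, ← Complex.ofReal_inv]
        exact Complex.zero_le_real.2 (inv_nonneg.2 ht')
      have hs : IsState ((P.trace)⁻¹ • P) :=
        ⟨hx.smul ht0, by rw [trace_smul, smul_eq_mul, inv_mul_cancel₀ ht]⟩
      have h1 : E (((P.trace)⁻¹ • P) ⊗ₖ (1 : Op B)) = 1 := (h _ hs).2
      change E (P ⊗ₖ uniform B) = P.trace • uniform B
      rw [smul_kronecker, map_smul, inv_smul_eq_iff₀ ht] at h1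
      rw [uniform, kronecker_smul, map_smul, h1, smul_comm]
  · intro h τ hτ
    refine ⟨isChannel_condMap hE hτ, ?_⟩
    change E (τ ⊗ₖ 1) = 1
    rw [← card_smul_uniform (B := B), kronecker_smul, map_smul, h, hτ.2, one_smul]

/-- Each component of `N` is `g(·) u`, so `id_R` tensored with it produces an operator on `R`
tensored with `u`, which `E` sends to a multiple of `u`. Any realization will do, minimal or not. -/
theorem IsRealization.isCompletelyUniformityPreserving {A A' R : Type} [Fintype A]
    [Fintype A'] [DecidableEq A'] [Fintype R] [Nonempty B] {Θ : Supermap A B A' B}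
    {E : Op (R × B) →ₗ[ℂ] Op B} {V : Matrix (R × A) A' ℂ} (h : IsRealization Θ E V)
    (hE : IsConditionallyUnital E) : IsCompletelyUniformityPreserving Θ := by
  intro C₀ C₁ _ _ _ _ N _ hN
  rw [isConditionallyUnital_iff h.1] at hE
  refine isMarginallyUniform_of_exists fun Y => ?_
  let g : C₀ → C₀ → C₁ → C₁ → Op A → ℂ := fun c₀ c₀' c₁ c₁' X =>
    trLeft (N (X ⊗ₖ single c₀ c₀' (1 : ℂ))) c₁ c₁'
  have hg : ∀ c₀ c₀' c₁ c₁' X, component N c₀ c₀' c₁ c₁' X = g c₀ c₀' c₁ c₁' X • uniform B := by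
    intro c₀ c₀' c₁ c₁' X
    change blockR (N (X ⊗ₖ single c₀ c₀' (1 : ℂ))) c₁ c₁' = _
    rw [hN]
    ext b b'
    simp only [blockR, of_apply, kroneckerMap_apply, Matrix.smul_apply, smul_eq_mul, mul_comm, g]
  refine ⟨Matrix.of fun c₁ c₁' => ∑ c₀, ∑ c₀', (Matrix.of fun r r' => g c₀ c₀' c₁ c₁'
    (blockL (conj V (blockR Y c₀ c₀')) r r') : Op R).trace, ?_⟩
  ext ⟨b, c₁⟩ ⟨b', c₁'⟩
  simp only [extend, LinearMap.coe_mk, AddHom.coe_mk, of_apply, kroneckerMap_apply, h.2.2,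
    LinearMap.comp_apply, idTensor_smul_const (hg _ _ _ _), hE, Matrix.smul_apply, smul_eq_mul,
    Finset.mul_sum, mul_comm]

theorem component_uniformId {A : Type} (a a' : A) (X : Op A) :
    component (uniformId A B) () () a a' X = X a a' • uniform B := by
  ext b b'
  simp [component, uniformId, blockR, mul_comm]

/-- The left side is a block of `Θ ⊗ 𝟙` applied to `u ⊗ id`, evaluated at a matrix unit of `A'`.
Marginal uniformity makes it a multiple of `u`, and trace preservation of `E` fixes the factor. -/
theorem IsRealization.apply_ancilla_kronecker_uniform {A A' R : Type} [Fintype A]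
    [Fintype A'] [DecidableEq A'] [Fintype R] [Nonempty B] {Θ : Supermap A B A' B}
    {E : Op (R × B) →ₗ[ℂ] Op B} {V : Matrix (R × A) A' ℂ} (h : IsRealization Θ E V)
    (hΘ : IsMarginallyUniform (extend Θ (uniformId A B))) (p q : A × A') :
    E (vecMulVec ((ancilla V).col p) (star ((ancilla V).col q)) ⊗ₖ uniform B) =
      (vecMulVec ((ancilla V).col p) (star ((ancilla V).col q))).trace • uniform B := by
  rw [← blockR_conj_single V p.1 q.1 p.2 q.2]
  set X := blockR (conj V (single p.2 q.2 1)) p.1 q.1 with hX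
  let Y : Op (A' × Unit) := Matrix.of fun s t => single p.2 q.2 (1 : ℂ) s.1 t.1
  obtain ⟨z, hz⟩ : ∃ z : ℂ, E (X ⊗ₖ uniform B) = z • uniform B := by
    refine ⟨trLeft (extend Θ (uniformId A B) Y) p.1 q.1, ?_⟩
    ext b b'
    have h1 := congrFun (congrFun (hΘ Y) (b, p.1)) (b', q.1)
    rw [kroneckerMap_apply, mul_comm] at h1
    rw [Matrix.smul_apply, smul_eq_mul, ← h1]
    simp only [extend, LinearMap.coe_mk, AddHom.coe_mk, of_apply, Finset.univ_unique,
      Finset.sum_singleton, h.2.2, LinearMap.comp_apply]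
    have h2 := idTensor_smul_const (component_uniformId (B := B) p.1 q.1)
      (conj V (single p.2 q.2 1))
    exact congrArg (fun M => E M b b') h2.symm
  have ht := congrArg trace hz
  rw [h.1.2, trace_kronecker, trace_smul, trace_uniform, mul_one, smul_eq_mul, mul_one] at ht
  rw [hz, ht]

theorem isChannel_uniformId {A : Type} [Fintype A] [Nonempty B] :
    IsChannel (uniformId A B) := by
  constructor
  · intro n ρ hρ
    have h : tensorId (uniformId A B) (Fin n) ρ = tensorId (kroneckerLeft (uniform B) A) (Fin n)
        (ρ.submatrix (fun p => ((p.1, ()), p.2)) fun p => ((p.1, ()), p.2)) := by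
      ext p q
      simp only [tensorId, uniformId, kroneckerLeft, blockR, LinearMap.coe_mk, AddHom.coe_mk,
        of_apply, kroneckerMap_apply, submatrix_apply]
    rw [h]
    exact isCP_kroneckerLeft posSemidef_uniform n _ (hρ.submatrix _)
  · intro ρ
    change (uniform B ⊗ₖ blockR ρ () ()).trace = _
    rw [trace_kronecker, trace_uniform, one_mul]
    simp [trace, blockR, Fintype.sum_prod_type]

theorem isMarginallyUniform_uniformId {A : Type} [Nonempty B] :
    IsMarginallyUniform (uniformId A B) :=
  isMarginallyUniform_of_exists fun _ => ⟨_, rfl⟩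

end Uniform

/-! ### Standard forms -/

theorem ancilla_kronecker_mul {A A' R S : Type} [Fintype A] [DecidableEq A] [Fintype R]
    (P : Matrix S R ℂ) (V : Matrix (R × A) A' ℂ) :
    ancilla ((P ⊗ₖ (1 : Op A)) * V) = P * ancilla V := by
  ext s p
  simp [ancilla, mul_apply, Fintype.sum_prod_type, one_apply]

theorem ancilla_injective {A A' R : Type} :
    Function.Injective (ancilla : Matrix (R × A) A' ℂ → Matrix R (A × A') ℂ) := by
  intro V W h
  ext ⟨r, a⟩ c
  exact congrFun (congrFun h r) (a, c)

theorem conj_mul {X Y Z : Type} [Fintype X] [Fintype Y] (K : Matrix Z Y ℂ) (K' : Matrix Y X ℂ) :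
    conj (K * K') = conj K ∘ₗ conj K' := by
  refine LinearMap.ext fun ρ => ?_
  change K * K' * ρ * (K * K')ᴴ = K * (K' * ρ * K'ᴴ) * Kᴴ
  rw [conjTranspose_mul]
  simp only [Matrix.mul_assoc]

theorem isTP_conj {X Y : Type} [Fintype X] [DecidableEq X] [Fintype Y] {W : Matrix Y X ℂ}
    (hW : Wᴴ * W = 1) : IsTP (conj W) := by
  intro Z
  change (W * Z * Wᴴ).trace = _
  rw [trace_mul_cycle, hW, Matrix.one_mul]

/-- Operations on the ancilla commute with `N`; this moves a change of ancilla from `V` into `E`. -/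
theorem idTensor_comp_conj {A B R S : Type} [Fintype A] [DecidableEq A] [Fintype B]
    [DecidableEq B] [Fintype S] (W : Matrix R S ℂ) (N : Op A →ₗ[ℂ] Op B) :
    idTensor R N ∘ₗ conj (W ⊗ₖ (1 : Op A)) = conj (W ⊗ₖ (1 : Op B)) ∘ₗ idTensor S N := by
  refine LinearMap.ext fun Z => ?_
  ext ⟨r, b⟩ ⟨r', b'⟩
  have h1 : blockL (conj (W ⊗ₖ (1 : Op A)) Z) r r' =
      ∑ s', ∑ s, (W r s * star (W r' s')) • blockL Z s s' := by
    ext a a'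
    simp [conj, blockL, mul_apply, Fintype.sum_prod_type, one_apply, Matrix.sum_apply,
      Finset.sum_mul, apply_ite, mul_right_comm]
  change N (blockL (conj (W ⊗ₖ (1 : Op A)) Z) r r') b b' = _
  rw [h1]
  simp [conj, idTensor, mul_apply, Fintype.sum_prod_type, one_apply, Matrix.sum_apply,
      Finset.sum_mul, apply_ite, mul_right_comm]

/-- In a standard form, the ancilla vectors span the auxiliary system. -/
theorem IsStandardForm.exists_ancilla_mul_eq_one {A A' B R : Type} [Fintype A] [DecidableEq A]
    [Fintype A'] [DecidableEq A'] [Fintype B] [DecidableEq B] [Fintype R] [DecidableEq R]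
    {Θ : Supermap A B A' B} {E : Op (R × B) →ₗ[ℂ] Op B} {V : Matrix (R × A) A' ℂ}
    (h : IsStandardForm Θ E V) : ∃ K : Matrix (A × A') R ℂ, ancilla V * K = 1 := by
  obtain ⟨⟨hE, hV, hΘ⟩, hmin⟩ := h
  obtain ⟨r, W, d, hd, hW, hH⟩ :=
    (posSemidef_self_mul_conjTranspose (ancilla V)).exists_isometry_diagonal
  have hWM : W * Wᴴ * ancilla V = ancilla V := by
    have h0 : (1 - W * Wᴴ) * (ancilla V * (ancilla V)ᴴ) = 0 := by
      rw [hH, Matrix.sub_mul, Matrix.one_mul, sub_eq_zero]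
      simp only [Matrix.mul_assoc]
      rw [← Matrix.mul_assoc Wᴴ W, hW, Matrix.one_mul]
    rw [mul_self_mul_conjTranspose_eq_zero, Matrix.sub_mul, Matrix.one_mul, sub_eq_zero] at h0
    exact h0.symm
  -- The range of `W` is the span of the ancilla vectors. Compressing `R` to it gives a realization
  -- of dimension `r`, so minimality will force `W` to be unitary.
  let V' : Matrix (Fin r × A) A' ℂ := (Wᴴ ⊗ₖ (1 : Op A)) * V
  have hVV' : (W ⊗ₖ (1 : Op A)) * V' = V := by
    refine ancilla_injective ?_
    rw [ancilla_kronecker_mul, ancilla_kronecker_mul, ← Matrix.mul_assoc, hWM]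
  have hWB : (W ⊗ₖ (1 : Op B))ᴴ * (W ⊗ₖ (1 : Op B)) = 1 := by
    rw [conjTranspose_kronecker, ← mul_kronecker_mul, hW, conjTranspose_one, Matrix.one_mul,
      one_kronecker_one]
  have hreal : IsRealization Θ (E ∘ₗ conj (W ⊗ₖ (1 : Op B))) V' := by
    refine ⟨⟨hE.1.comp (isCP_conj _), fun Z => ?_⟩, ?_, fun N => ?_⟩
    · rw [LinearMap.comp_apply, hE.2, isTP_conj hWB]
    · have : V'ᴴ = Vᴴ * (W ⊗ₖ (1 : Op A)) := by
        rw [conjTranspose_mul, conjTranspose_kronecker, conjTranspose_conjTranspose,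
          conjTranspose_one]
      rw [this, Matrix.mul_assoc, hVV', hV]
    · rw [hΘ N, LinearMap.comp_assoc, ← LinearMap.comp_assoc (conj V'), ← idTensor_comp_conj,
        LinearMap.comp_assoc, ← conj_mul, hVV']
  have hle := hmin r _ _ hreal
  have hge : r ≤ Fintype.card R := by
    have h1 : (Wᴴ * W).rank ≤ Fintype.card R := (rank_mul_le_right _ _).trans (rank_le_card_height _)
    rwa [hW, rank_one, Fintype.card_fin] at h1
  have hWW : W * Wᴴ = 1 :=
    (mul_eq_one_comm_of_card_eq _ _ _ (by rw [Fintype.card_fin]; omega)).1 hW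
  -- With `M = ancilla V`, this is the right inverse `Mᴴ (M Mᴴ)⁻¹`.
  refine ⟨(ancilla V)ᴴ * (W * diagonal (fun i => ((d i : ℂ))⁻¹) * Wᴴ), ?_⟩
  have hdd : diagonal (fun i => (d i : ℂ)) * diagonal (fun i => ((d i : ℂ))⁻¹) = 1 := by
    rw [diagonal_mul_diagonal, ← diagonal_one]
    congr 1
    ext i
    exact mul_inv_cancel₀ (by exact_mod_cast (hd i).ne')
  rw [← Matrix.mul_assoc, hH]
  calc W * diagonal (fun i => (d i : ℂ)) * Wᴴ * (W * diagonal (fun i => ((d i : ℂ))⁻¹) * Wᴴ)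
      = W * (diagonal (fun i => (d i : ℂ)) * ((Wᴴ * W) * diagonal (fun i => ((d i : ℂ))⁻¹))) * Wᴴ
          := by simp only [Matrix.mul_assoc]
    _ = 1 := by rw [hW, Matrix.one_mul, hdd, Matrix.mul_one, hWW]

theorem mul_mul_conjTranspose_eq_sum {R P : Type} [Fintype P] (M : Matrix R P ℂ) (C : Op P) :
    M * C * Mᴴ = ∑ p, ∑ q, C p q • vecMulVec (M.col p) (star (M.col q)) := by
  ext r r'
  simp only [mul_apply, conjTranspose_apply, Matrix.sum_apply, Matrix.smul_apply, vecMulVec_apply,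
    Finset.sum_mul, smul_eq_mul, Pi.star_apply, col_apply]
  rw [Finset.sum_comm]
  refine Finset.sum_congr rfl fun p _ => Finset.sum_congr rfl fun q _ => ?_
  ring

/-- A right inverse of `ancilla V` writes any `X` on `R` as a combination of dyads of ancilla
vectors, where `E(X ⊗ u) = Tr(X) u` is already known. -/
theorem IsStandardForm.isConditionallyUnital {A A' B R : Type} [Fintype A] [DecidableEq A]
    [Fintype A'] [DecidableEq A'] [Fintype B] [DecidableEq B] [Nonempty B] [Fintype R]
    [DecidableEq R] {Θ : Supermap A B A' B} {E : Op (R × B) →ₗ[ℂ] Op B}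
    {V : Matrix (R × A) A' ℂ} (h : IsStandardForm Θ E V)
    (hΘ : IsMarginallyUniform (extend Θ (uniformId A B))) : IsConditionallyUnital E := by
  rw [isConditionallyUnital_iff h.1.1]
  intro X
  obtain ⟨K, hK⟩ := h.exists_ancilla_mul_eq_one
  let F : Op R →ₗ[ℂ] Op B := E ∘ₗ kroneckerRight R (uniform B)
  let G : Op R →ₗ[ℂ] Op B := (traceLinearMap R ℂ ℂ).smulRight (uniform B)
  have hFG : ∀ p q, F (vecMulVec ((ancilla V).col p) (star ((ancilla V).col q))) =
      G (vecMulVec ((ancilla V).col p) (star ((ancilla V).col q))) :=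
    h.1.apply_ancilla_kronecker_uniform hΘ
  have hX : X = ancilla V * (K * X * Kᴴ) * (ancilla V)ᴴ := by
    calc X = (ancilla V * K) * X * (ancilla V * K)ᴴ := by
          rw [hK, conjTranspose_one, Matrix.one_mul, Matrix.mul_one]
      _ = _ := by rw [conjTranspose_mul]; simp only [Matrix.mul_assoc]
  change F X = G X
  rw [hX, mul_mul_conjTranspose_eq_sum]
  simp only [map_sum, map_smul, hFG]

theorem IsSuperchannel.exists_isStandardForm {A A' B : Type} [Fintype A] [DecidableEq A]
    [Fintype A'] [DecidableEq A'] [Fintype B] [DecidableEq B] [Nonempty B]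
    {Θ : Supermap A B A' B} (hΘ : IsSuperchannel Θ) :
    ∃ (r : ℕ) (E : Op (Fin r × B) →ₗ[ℂ] Op B) (V : Matrix (Fin r × A) A' ℂ),
      IsStandardForm Θ E V := by
  classical
  have hex := hΘ.exists_isRealization
  obtain ⟨E, V, h⟩ := Nat.find_spec hex
  refine ⟨_, E, V, h, fun r E' V' h' => ?_⟩
  rw [Fintype.card_fin]
  exact Nat.find_min' hex ⟨E', V', h'⟩

end QChan

theorem theorem11 {A A' B : Type} [Fintype A] [DecidableEq A] [Nonempty A]
    [Fintype A'] [DecidableEq A'] [Nonempty A'] [Fintype B] [DecidableEq B] [Nonempty B]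
    (Θ : QChan.Supermap A B A' B) (hΘ : QChan.IsSuperchannel Θ) :
    [QChan.IsCompletelyUniformityPreserving Θ,
      QChan.IsMarginallyUniform (QChan.extend Θ (QChan.uniformId A B)),
      QChan.IsMixing Θ].TFAE ∧
    ∀ (R : Type) [Fintype R] [DecidableEq R] (E : QChan.Op (R × B) →ₗ[ℂ] QChan.Op B)
      (V : Matrix (R × A) A' ℂ), QChan.IsStandardForm Θ E V →
      (QChan.IsConditionallyUnital E ↔ QChan.IsCompletelyUniformityPreserving Θ) := by
  have h12 : QChan.IsCompletelyUniformityPreserving Θ →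
      QChan.IsMarginallyUniform (QChan.extend Θ (QChan.uniformId A B)) := fun h =>
    -- `u ⊗ id` is itself an admissible input, with `C₀` trivial and `C₁ = A`.
    h Unit A _ QChan.isChannel_uniformId QChan.isMarginallyUniform_uniformId
  refine ⟨?_, fun R _ _ E V hEV => ⟨fun h => hEV.1.isCompletelyUniformityPreserving h,
    fun h => hEV.isConditionallyUnital (h12 h)⟩⟩
  tfae_have 1 → 2 := h12
  tfae_have 2 → 3 := fun h => by
    obtain ⟨r, E, V, hEV⟩ := hΘ.exists_isStandardForm
    exact ⟨r, E, V, hEV, hEV.isConditionallyUnital h⟩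
  tfae_have 3 → 1 := fun ⟨r, E, V, hEV, h⟩ => hEV.1.isCompletelyUniformityPreserving h
  tfae_finish
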